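/- Let $T>0$ and let $p,q:\mathbb R\to\mathbb R$ be $T$-periodic, with $p>0$ twice differentiable (so that $p'$ is continuous) and $q$ continuous. For $\lambda\in\mathbb C$ consider $$-(p f')'+q f=\lambda f \qquad (1)$$ for functions $f:\mathbb R\to\mathbb C$ such that $f$ and $pf'$ are differentiable. Let $\lambda_0$ be the smallest real number for which (1) has a nonzero $T$-periodic solution, and let $f_0$ be a corresponding real $T$-periodic solution without zeros. Put $$\Phi=-p^{1/2}\frac{f_0'}{f_0},\qquad \tilde q=q+2p^{1/2}\Phi'-p^{1/2}(p^{1/2})''.$$ Then $\Phi$ is differentiable, $\Phi$ and $\tilde q$ are $T$-periodic, and $\tilde q$ is continuous if $p''$ is. For all $f$ such that $f$ and $pf'$ are differentiable, writing $Af=p^{1/2}f'+\Phi f$ and $Bf=-(p^{1/2}f)'+\Phi f$, $$-(pf')'+qf=BAf+\lambda_0 f,\qquad -(pf')'+\tilde q f=ABf+\lambda_0 f .$$ For every $\lambda\in\mathbb C$, the Darboux transformation $f\mapsto \tilde f=Af=p^{1/2}f'+\Phi f$ maps each solution of (1) to a solution of the supersymmetric partner equation $$-(p\tilde f')'+\tilde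 q\tilde f=\lambda\tilde f. \qquad (2)$$ Moreover, for every $\lambda\in\mathbb C$, each of the equations (1) and (2) has a unique pair of solutions $f_1,f_2$ (respectively $\tilde f_1,\tilde f_2$) on $\mathbb R$ with $f_1(0)=f_2'(0)=1$, $f_1'(0)=f_2(0)=0$ (respectively the same conditions for $\tilde f_1,\tilde f_2$), and the Hill discriminants $D(\lambda)=f_1(T)+f_2'(T)$ and $\tilde D(\lambda)=\tilde f_1(T)+\tilde f_2'(T)$ coincide: $$\tilde D(\lambda)=D(\lambda)\qquad\text{for all }\lambda\in\mathbb C .$$ -/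

import Mathlib

/-- The Sturm-Liouville expression `-(p f')' + q f`. -/
noncomputable def slOp (p q : ℝ → ℝ) (f : ℝ → ℂ) : ℝ → ℂ := fun x =>
  -deriv (fun y => (p y : ℂ) * deriv f y) x + (q x : ℂ) * f x

/-- The functions on which `slOp` acts classically: `f` and `p f'` are differentiable on `ℝ`. -/
def SLDomain (p : ℝ → ℝ) (f : ℝ → ℂ) : Prop :=
  Differentiable ℝ f ∧ Differentiable ℝ (fun y => (p y : ℂ) * deriv f y)

/-- `f` is a (classical) solution on `ℝ` of `-(p f')' + q f = lam f`. -/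
def IsSLSolution (p q : ℝ → ℝ) (lam : ℂ) (f : ℝ → ℂ) : Prop :=
  SLDomain p f ∧ ∀ x, slOp p q f x = lam * f x

/-- `f` is an eigenfunction, with eigenvalue `lam`, of the `T`-periodic problem: a solution of
`-(p f')' + q f = lam f` that is `T`-periodic and not identically zero. -/
def IsPeriodicEigenfunction (p q : ℝ → ℝ) (T : ℝ) (lam : ℂ) (f : ℝ → ℂ) : Prop :=
  IsSLSolution p q lam f ∧ Function.Periodic f T ∧ f ≠ 0

/-- `lam0` is the first (smallest) eigenvalue of the `T`-periodic problem. -/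
def IsFirstPeriodicEigenvalue (p q : ℝ → ℝ) (T : ℝ) (lam0 : ℝ) : Prop :=
  IsLeast {mu : ℝ | ∃ f : ℝ → ℂ, IsPeriodicEigenfunction p q T (mu : ℂ) f} lam0

/-- The pair `F = (f₁, f₂)` of solutions of `-(p f')' + q f = lam f` with
`f₁(0) = 1, f₁'(0) = 0, f₂(0) = 0, f₂'(0) = 1`. -/
def IsFundamentalSystem (p q : ℝ → ℝ) (lam : ℂ) (F : (ℝ → ℂ) × (ℝ → ℂ)) : Prop :=
  IsSLSolution p q lam F.1 ∧ IsSLSolution p q lam F.2 ∧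
    F.1 0 = 1 ∧ deriv F.1 0 = 0 ∧ F.2 0 = 0 ∧ deriv F.2 0 = 1

open Classical in
/-- Hill's discriminant `D(lam) = f₁(T, lam) + f₂'(T, lam)`. (The default value `0` concerns only
equations without a fundamental system.) -/
noncomputable def hillDiscriminant (p q : ℝ → ℝ) (T : ℝ) (lam : ℂ) : ℂ :=
  if h : ∃ F, IsFundamentalSystem p q lam F then h.choose.1 T + deriv h.choose.2 T else 0

/-- The superpotential `Φ = -p^{1/2} f₀' / f₀`. -/
noncomputable def superpotential (p f0 : ℝ → ℝ) : ℝ → ℝ := fun x =>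
  -√(p x) * (deriv f0 x / f0 x)

/-- The Darboux transformation `f ↦ p^{1/2} f' + Φ f`. -/
noncomputable def darboux (p Φ : ℝ → ℝ) (f : ℝ → ℂ) : ℝ → ℂ := fun x =>
  (√(p x) : ℂ) * deriv f x + (Φ x : ℂ) * f x

/-- The other factor, `f ↦ -(p^{1/2} f)' + Φ f`. -/
noncomputable def darbouxAdjoint (p Φ : ℝ → ℝ) (f : ℝ → ℂ) : ℝ → ℂ := fun x =>
  -deriv (fun y => (√(p y) : ℂ) * f y) x + (Φ x : ℂ) * f x

/-- The partner coefficient `q + 2 p^{1/2} Φ' - p^{1/2} (p^{1/2})''`. -/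
noncomputable def susyPartner (p q Φ : ℝ → ℝ) : ℝ → ℝ := fun x =>
  q x + 2 * √(p x) * deriv Φ x - √(p x) * deriv (deriv (fun y => √(p y))) x

/-!
The superpotential satisfies the Riccati equation `(p^{1/2} Φ)' = lam0 - q + Φ²`
(`isRiccatiSolution_superpotential`), because `p^{1/2} Φ = -p f₀' / f₀`. With
`A f = p^{1/2} f' + Φ f` and `B f = -(p^{1/2} f)' + Φ f`, both factorizations, into `B A + lam0` and
into `A B + lam0`, are pointwise computations from it. If `B A f = (lam - lam0) f`, then
`(p^{1/2} A f)' = Φ A f - (lam - lam0) f`, so `A f` is regular enough for `A B` to act on it, and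
`A B A f = (lam - lam0) A f`.

Existence and uniqueness hold for linear first-order systems with continuous coefficients on `ℝ`,
by the Peano series and Grönwall's inequality (`exists_hasDerivAt_linear`,
`eq_zero_of_hasDerivAt_linear`). The original equation is such a system for `f` and `p f'`. The
partner coefficient involves `p''` and need not be continuous; the partner equation is therefore
read as the system for `p^{1/2} f` and `B f`, whose coefficients are continuous
(`IsRiccatiSolution.isSLSolution_partner_of_system` and
`IsRiccatiSolution.system_of_isSLSolution_partner`).

The discriminant is the trace of the monodromy matrix. For `lam ≠ lam0` the Darboux transformation
is injective on solutions, since `B A f = (lam - lam0) f`, and commutes with the translation by `T`,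
so the two monodromy matrices are similar (`trace_monodromy_partner_eq`). For `lam = lam0` both
equations have a nonzero periodic solution, `f₀` and `1 / (p^{1/2} f₀)`; the monodromy matrix has
determinant `1` by the Wronskian identity, so both traces are `2`
(`IsFundamentalSystem.trace_monodromy_eq_two`).
-/

/-! ### Linear ordinary differential equations on the whole line -/

section LinearODE

variable {E : Type*} [NormedAddCommGroup E] [NormedSpace ℝ E]

/-- The terms of the Peano series `x₀ + ∫ A x₀ + ∫ A ∫ A x₀ + ⋯` solving `u' = A u`, `u 0 = x₀`. -/
noncomputable def peanoTerm (A : ℝ → E →L[ℝ] E) (x₀ : E) : ℕ → ℝ → E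
  | 0 => fun _ => x₀
  | n + 1 => fun t => ∫ s in (0 : ℝ)..t, A s (peanoTerm A x₀ n s)

theorem continuous_peanoTerm {A : ℝ → E →L[ℝ] E} (hA : Continuous A) (x₀ : E) (n : ℕ) :
    Continuous (peanoTerm A x₀ n) := by
  induction n with
  | zero => exact continuous_const
  | succ n ih =>
    exact intervalIntegral.continuous_primitive
      (fun a b => (hA.clm_apply ih).intervalIntegrable a b) 0

theorem hasDerivAt_peanoTerm_succ [CompleteSpace E] {A : ℝ → E →L[ℝ] E} (hA : Continuous A)
    (x₀ : E) (n : ℕ) (t : ℝ) :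
    HasDerivAt (peanoTerm A x₀ (n + 1)) (A t (peanoTerm A x₀ n t)) t :=
  (hA.clm_apply (continuous_peanoTerm hA x₀ n)).integral_hasStrictDerivAt 0 t |>.hasDerivAt

theorem norm_peanoTerm_le {A : ℝ → E →L[ℝ] E} (hA : Continuous A) (x₀ : E) {R K : ℝ}
    (hK : ∀ s, |s| ≤ R → ‖A s‖ ≤ K) (n : ℕ) {t : ℝ} (ht : |t| ≤ R) :
    ‖peanoTerm A x₀ n t‖ ≤ ‖x₀‖ * ((K * |t|) ^ n / n.factorial) := by
  have hK0 : 0 ≤ K := (norm_nonneg _).trans (hK t ht)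
  induction n generalizing t with
  | zero => simp [peanoTerm]
  | succ n ih =>
    have hbound : ∀ s ∈ Set.uIoc 0 t, ‖A s (peanoTerm A x₀ n s)‖ ≤
        ‖x₀‖ * K ^ (n + 1) / n.factorial * |s - 0| ^ n := by
      intro s hs
      have hs' : |s| ≤ R := by
        refine le_trans ?_ ht
        have := Set.abs_sub_left_of_mem_uIcc (Set.uIoc_subset_uIcc hs)
        simpa using this
      calc ‖A s (peanoTerm A x₀ n s)‖ ≤ ‖A s‖ * ‖peanoTerm A x₀ n s‖ := (A s).le_opNorm _
        _ ≤ K * (‖x₀‖ * ((K * |s|) ^ n / n.factorial)) :=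
            mul_le_mul (hK s hs') (ih hs') (norm_nonneg _) hK0
        _ = _ := by rw [sub_zero]; ring
    calc ‖peanoTerm A x₀ (n + 1) t‖
        ≤ ∫ s in Set.uIoc 0 t, ‖A s (peanoTerm A x₀ n s)‖ :=
          intervalIntegral.norm_integral_le_integral_norm_uIoc
      _ ≤ ∫ s in Set.uIoc 0 t, ‖x₀‖ * K ^ (n + 1) / n.factorial * |s - 0| ^ n := by
          refine MeasureTheory.setIntegral_mono_on ?_ ?_ measurableSet_uIoc hbound
          · exact ((hA.clm_apply (continuous_peanoTerm hA x₀ n)).norm.integrableOn_uIoc)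
          · exact Continuous.integrableOn_uIoc (by fun_prop)
      _ = ‖x₀‖ * ((K * |t|) ^ (n + 1) / (n + 1).factorial) := by
          rw [MeasureTheory.integral_const_mul, integral_pow_abs_sub_uIoc, sub_zero,
            Nat.factorial_succ, Nat.cast_mul, Nat.cast_succ, mul_pow]
          field_simp

/-- A linear equation with continuous coefficients has global solutions. -/
theorem exists_hasDerivAt_linear [CompleteSpace E] {A : ℝ → E →L[ℝ] E} (hA : Continuous A)
    (x₀ : E) : ∃ u : ℝ → E, u 0 = x₀ ∧ ∀ t, HasDerivAt u (A t (u t)) t := by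
  have hbd : ∀ R : ℝ, ∃ K, ∀ s, |s| ≤ R → ‖A s‖ ≤ K := by
    intro R
    obtain ⟨K, hK⟩ := (isCompact_Icc (a := -R) (b := R)).exists_bound_of_continuousOn
      hA.continuousOn
    exact ⟨K, fun s hs => hK s (abs_le.mp hs)⟩
  have hsum : ∀ t, Summable fun n => peanoTerm A x₀ n t := by
    intro t
    obtain ⟨K, hK⟩ := hbd |t|
    exact .of_norm_bounded ((Real.summable_pow_div_factorial (K * |t|)).mul_left ‖x₀‖)
      fun n => norm_peanoTerm_le hA x₀ hK n le_rfl
  have hsplit : (fun t => ∑' n, peanoTerm A x₀ n t) =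
      fun t => x₀ + ∑' n, peanoTerm A x₀ (n + 1) t :=
    funext fun t => (hsum t).tsum_eq_zero_add
  refine ⟨fun t => ∑' n, peanoTerm A x₀ n t, ?_, fun t => ?_⟩
  · rw [hsplit]
    simp [peanoTerm]
  · obtain ⟨K, hK⟩ := hbd (|t| + 1)
    have hK0 : 0 ≤ K := (norm_nonneg _).trans (hK t (by linarith))
    have hmem : ∀ s ∈ Set.Ioo (-(|t| + 1)) (|t| + 1), |s| ≤ |t| + 1 :=
      fun s hs => (abs_lt.mpr hs).le
    have key := hasDerivAt_tsum_of_isPreconnected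
      (((Real.summable_pow_div_factorial (K * (|t| + 1))).mul_left ‖x₀‖).mul_left K)
      isOpen_Ioo isPreconnected_Ioo
      (fun n s (_ : s ∈ Set.Ioo (-(|t| + 1)) (|t| + 1)) => hasDerivAt_peanoTerm_succ hA x₀ n s)
      (fun n s hs => by
        refine ((A s).le_opNorm _).trans
          (mul_le_mul (hK s (hmem s hs)) ?_ (norm_nonneg _) hK0)
        refine (norm_peanoTerm_le hA x₀ hK n (hmem s hs)).trans ?_
        have := hmem s hs
        gcongr)
      (y₀ := 0) (by constructor <;> linarith [abs_nonneg t])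
      ((summable_nat_add_iff 1).mpr (hsum 0))
      (y := t) (abs_lt.mp (lt_add_one _))
    rw [hsplit]
    beta_reduce
    rw [← congrFun hsplit t, (A t).map_tsum (hsum t)]
    exact key.const_add x₀

/-- A solution of a linear equation with continuous coefficients that vanishes at `0` vanishes
everywhere. -/
theorem eq_zero_of_hasDerivAt_linear {A : ℝ → E →L[ℝ] E} (hA : Continuous A) {u : ℝ → E}
    (hu : ∀ t, HasDerivAt u (A t (u t)) t) (h0 : u 0 = 0) (t : ℝ) : u t = 0 := by
  obtain ⟨K, hK⟩ := (isCompact_Icc (a := -(|t| + 1)) (b := |t| + 1)).exists_bound_of_continuousOn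
    hA.continuousOn
  refine ODE_solution_unique_of_mem_Ioo (f := u) (g := fun _ => 0) (v := fun s x => A s x)
    (s := fun _ => Set.univ) (K := K.toNNReal) (t₀ := 0) (a := -(|t| + 1)) (b := |t| + 1)
    (fun s hs => ?_) (by constructor <;> linarith [abs_nonneg t])
    (fun s _ => ⟨hu s, trivial⟩) (fun s _ => ⟨?_, trivial⟩) h0 (abs_lt.mp (lt_add_one _))
  · refine ((A s).lipschitz.weaken ?_).lipschitzOnWith
    rw [← NNReal.coe_le_coe]
    exact (hK s (Set.Ioo_subset_Icc_self hs)).trans (Real.le_coe_toNNReal K)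
  · simpa using hasDerivAt_const s (0 : E)

end LinearODE

/-- The coefficient map of the planar system `u' = a u + b v`, `v' = c u + d v`. -/
noncomputable def planarCLM (a b c d : ℂ) : ℂ × ℂ →L[ℝ] ℂ × ℂ :=
  (((a • ContinuousLinearMap.fst ℂ ℂ ℂ + b • ContinuousLinearMap.snd ℂ ℂ ℂ).prod
    (c • ContinuousLinearMap.fst ℂ ℂ ℂ + d • ContinuousLinearMap.snd ℂ ℂ ℂ))).restrictScalars ℝ

theorem planarCLM_apply (a b c d : ℂ) (z : ℂ × ℂ) :
    planarCLM a b c d z = (a * z.1 + b * z.2, c * z.1 + d * z.2) := rfl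

theorem continuous_planarCLM {a b c d : ℝ → ℂ} (ha : Continuous a) (hb : Continuous b)
    (hc : Continuous c) (hd : Continuous d) :
    Continuous fun t => planarCLM (a t) (b t) (c t) (d t) := by
  refine continuous_clm_apply.mpr fun z => ?_
  simp only [planarCLM_apply]
  fun_prop

theorem exists_planar_solution {a b c d : ℝ → ℂ} (ha : Continuous a) (hb : Continuous b)
    (hc : Continuous c) (hd : Continuous d) (u₀ v₀ : ℂ) :
    ∃ u v : ℝ → ℂ, u 0 = u₀ ∧ v 0 = v₀ ∧ (∀ t, HasDerivAt u (a t * u t + b t * v t) t) ∧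
      ∀ t, HasDerivAt v (c t * u t + d t * v t) t := by
  obtain ⟨z, hz0, hz⟩ := exists_hasDerivAt_linear (continuous_planarCLM ha hb hc hd) (u₀, v₀)
  refine ⟨fun t => (z t).1, fun t => (z t).2, by simp [hz0], by simp [hz0], fun t => ?_,
    fun t => ?_⟩
  · exact (hasFDerivAt_fst (𝕜 := ℝ)).comp_hasDerivAt t (hz t)
  · exact (hasFDerivAt_snd (𝕜 := ℝ)).comp_hasDerivAt t (hz t)

theorem planar_solution_eq_zero {a b c d : ℝ → ℂ} (ha : Continuous a) (hb : Continuous b)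
    (hc : Continuous c) (hd : Continuous d) {u v : ℝ → ℂ}
    (hu : ∀ t, HasDerivAt u (a t * u t + b t * v t) t)
    (hv : ∀ t, HasDerivAt v (c t * u t + d t * v t) t) (hu0 : u 0 = 0) (hv0 : v 0 = 0) (t : ℝ) :
    u t = 0 ∧ v t = 0 := by
  have := eq_zero_of_hasDerivAt_linear (continuous_planarCLM ha hb hc hd)
    (u := fun t => (u t, v t)) (fun t => (hu t).prodMk (hv t)) (by simp [hu0, hv0]) t
  exact Prod.mk_eq_zero.mp this

/-! ### Sturm–Liouville equations and the monodromy matrix -/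

section SturmLiouville

variable {p q : ℝ → ℝ} {lam : ℂ} {T : ℝ}

theorem hasDerivAt_ofReal_comp {h : ℝ → ℝ} (hh : Differentiable ℝ h) (x : ℝ) :
    HasDerivAt (fun y => (h y : ℂ)) ((deriv h x : ℝ) : ℂ) x :=
  (hh x).hasDerivAt.ofReal_comp

theorem SLDomain.differentiable_deriv (hp_pos : ∀ x, 0 < p x) (hp : Differentiable ℝ p)
    {f : ℝ → ℂ} (hf : SLDomain p f) : Differentiable ℝ (deriv f) := by
  have h : deriv f = fun y => ((p y : ℂ) * deriv f y) / (p y : ℂ) := funext fun y => by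
    have : (p y : ℂ) ≠ 0 := by exact_mod_cast (hp_pos y).ne'
    field_simp
  rw [h]
  exact hf.2.fun_div (fun x => (hasDerivAt_ofReal_comp hp x).differentiableAt)
    fun x => by exact_mod_cast (hp_pos x).ne'

theorem IsSLSolution.hasDerivAt_quasi {f : ℝ → ℂ} (hf : IsSLSolution p q lam f) (x : ℝ) :
    HasDerivAt (fun y => (p y : ℂ) * deriv f y) ((q x - lam) * f x) x := by
  have h := hf.2 x
  rw [slOp] at h
  have h' : (q x - lam) * f x = deriv (fun y => (p y : ℂ) * deriv f y) x := by
    linear_combination h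
  rw [h']
  exact (hf.1.2 x).hasDerivAt

theorem isSLSolution_of_hasDerivAt {f g : ℝ → ℂ} (hp_pos : ∀ x, 0 < p x)
    (hf : ∀ x, HasDerivAt f (g x / p x) x)
    (hg : ∀ x, HasDerivAt g ((q x - lam) * f x) x) : IsSLSolution p q lam f := by
  have hfg : (fun y => (p y : ℂ) * deriv f y) = g := funext fun y => by
    have : (p y : ℂ) ≠ 0 := by exact_mod_cast (hp_pos y).ne'
    rw [(hf y).deriv]
    field_simp
  refine ⟨⟨fun x => (hf x).differentiableAt, ?_⟩, fun x => ?_⟩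
  · rw [hfg]
    exact fun x => (hg x).differentiableAt
  · rw [slOp, hfg, (hg x).deriv]
    ring

theorem IsSLSolution.linearCombination {f g : ℝ → ℂ} (hf : IsSLSolution p q lam f)
    (hg : IsSLSolution p q lam g) (a b : ℂ) :
    IsSLSolution p q lam fun x => a * f x + b * g x := by
  have hd : ∀ x, HasDerivAt (fun x => a * f x + b * g x) (a * deriv f x + b * deriv g x) x :=
    fun x => ((hf.1.1 x).hasDerivAt.const_mul a).add ((hg.1.1 x).hasDerivAt.const_mul b)
  have hquasi : (fun y => (p y : ℂ) * deriv (fun x => a * f x + b * g x) y) =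
      fun y => a * ((p y : ℂ) * deriv f y) + b * ((p y : ℂ) * deriv g y) := funext fun y => by
    rw [(hd y).deriv]
    ring
  have hd2 : ∀ x, HasDerivAt (fun y => a * ((p y : ℂ) * deriv f y) + b * ((p y : ℂ) * deriv g y))
      (a * ((q x - lam) * f x) + b * ((q x - lam) * g x)) x :=
    fun x => ((hf.hasDerivAt_quasi x).const_mul a).add ((hg.hasDerivAt_quasi x).const_mul b)
  refine ⟨⟨fun x => (hd x).differentiableAt, ?_⟩, fun x => ?_⟩
  · rw [hquasi]
    exact fun x => (hd2 x).differentiableAt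
  · rw [slOp, hquasi, (hd2 x).deriv]
    ring

theorem deriv_linearCombination {f g : ℝ → ℂ} (hf : Differentiable ℝ f) (hg : Differentiable ℝ g)
    (a b : ℂ) (x : ℝ) :
    deriv (fun x => a * f x + b * g x) x = a * deriv f x + b * deriv g x :=
  (((hf x).hasDerivAt.const_mul a).add ((hg x).hasDerivAt.const_mul b)).deriv

theorem IsSLSolution.comp_add_period (hp : Function.Periodic p T) (hq : Function.Periodic q T)
    {f : ℝ → ℂ} (hf : IsSLSolution p q lam f) : IsSLSolution p q lam fun x => f (x + T) := by
  have hquasi : (fun y => (p y : ℂ) * deriv (fun x => f (x + T)) y) =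
      fun y => (fun z => (p z : ℂ) * deriv f z) (y + T) := funext fun y => by
    simp only [deriv_comp_add_const, hp y]
  have hd2 : ∀ x, HasDerivAt (fun y => (fun z => (p z : ℂ) * deriv f z) (y + T))
      ((q (x + T) - lam) * f (x + T)) x :=
    fun x => (hf.hasDerivAt_quasi (x + T)).comp_add_const x T
  refine ⟨⟨fun x => ((hf.1.1 (x + T)).hasDerivAt.comp_add_const x T).differentiableAt, ?_⟩,
    fun x => ?_⟩
  · rw [hquasi]
    exact fun x => (hd2 x).differentiableAt
  · rw [slOp, hquasi, (hd2 x).deriv, hq x]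
    ring

/-- A solution of `-(p f')' + q f = lam f` is determined by `f 0` and `f' 0`. -/
def SLUnique (p q : ℝ → ℝ) (lam : ℂ) : Prop :=
  ∀ f, IsSLSolution p q lam f → f 0 = 0 → deriv f 0 = 0 → ∀ x, f x = 0

theorem SLUnique.eq_of_data (h : SLUnique p q lam) {f g : ℝ → ℂ} (hf : IsSLSolution p q lam f)
    (hg : IsSLSolution p q lam g) (h0 : f 0 = g 0) (h1 : deriv f 0 = deriv g 0) : f = g := by
  have := h _ (hf.linearCombination hg 1 (-1)) (by simp [h0])
    (by rw [deriv_linearCombination hf.1.1 hg.1.1, h1]; ring)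
  exact funext fun x => by linear_combination this x

theorem SLUnique.existsUnique_fundamentalSystem (h : SLUnique p q lam)
    (hex : ∀ a b : ℂ, ∃ f, IsSLSolution p q lam f ∧ f 0 = a ∧ deriv f 0 = b) :
    ∃! F, IsFundamentalSystem p q lam F := by
  obtain ⟨f, hf, hf0, hf1⟩ := hex 1 0
  obtain ⟨g, hg, hg0, hg1⟩ := hex 0 1
  refine ⟨(f, g), ⟨hf, hg, hf0, hf1, hg0, hg1⟩, fun F hF => ?_⟩
  obtain ⟨h1, h2, h3, h4, h5, h6⟩ := hF
  exact Prod.ext (h.eq_of_data h1 hf (h3.trans hf0.symm) (h4.trans hf1.symm))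
    (h.eq_of_data h2 hg (h5.trans hg0.symm) (h6.trans hg1.symm))

theorem hillDiscriminant_eq (h : ∃! F, IsFundamentalSystem p q lam F) {F : (ℝ → ℂ) × (ℝ → ℂ)}
    (hF : IsFundamentalSystem p q lam F) :
    hillDiscriminant p q T lam = F.1 T + deriv F.2 T := by
  have hex : ∃ F, IsFundamentalSystem p q lam F := ⟨F, hF⟩
  rw [hillDiscriminant, dif_pos hex, h.unique hex.choose_spec hF]

theorem IsFundamentalSystem.expansion {F : (ℝ → ℂ) × (ℝ → ℂ)} (hF : IsFundamentalSystem p q lam F)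
    (h : SLUnique p q lam) {f : ℝ → ℂ} (hf : IsSLSolution p q lam f) :
    f = fun x => f 0 * F.1 x + deriv f 0 * F.2 x := by
  obtain ⟨h1, h2, h3, h4, h5, h6⟩ := hF
  refine h.eq_of_data hf (h1.linearCombination h2 _ _) ?_ ?_
  · simp [h3, h5]
  · rw [deriv_linearCombination h1.1.1 h2.1.1, h4, h6]
    ring

/-- The monodromy matrix of the pair `F`, whose columns are the Cauchy data at `T`; its trace is the
discriminant. -/
noncomputable def monodromy (F : (ℝ → ℂ) × (ℝ → ℂ)) (T : ℝ) : Matrix (Fin 2) (Fin 2) ℂ :=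
  !![F.1 T, F.2 T; deriv F.1 T, deriv F.2 T]

theorem trace_monodromy (F : (ℝ → ℂ) × (ℝ → ℂ)) (T : ℝ) :
    (monodromy F T).trace = F.1 T + deriv F.2 T := by
  simp [monodromy, Matrix.trace_fin_two]

/-- The monodromy matrix sends the Cauchy data at `0` of solutions to those at `T`. -/
theorem IsFundamentalSystem.monodromy_mul {F : (ℝ → ℂ) × (ℝ → ℂ)}
    (hF : IsFundamentalSystem p q lam F) (h : SLUnique p q lam) {f g : ℝ → ℂ}
    (hf : IsSLSolution p q lam f) (hg : IsSLSolution p q lam g) :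
    monodromy F T * !![f 0, g 0; deriv f 0, deriv g 0] =
      !![f T, g T; deriv f T, deriv g T] := by
  have aux : ∀ {f : ℝ → ℂ}, IsSLSolution p q lam f → f T = F.1 T * f 0 + F.2 T * deriv f 0 ∧
      deriv f T = deriv F.1 T * f 0 + deriv F.2 T * deriv f 0 := by
    intro f hf
    have e := hF.expansion h hf
    constructor
    · refine (congrFun e T).trans ?_
      ring
    · refine (congrArg (fun g => deriv g T) e).trans ?_
      rw [deriv_linearCombination hF.1.1.1 hF.2.1.1.1]
      ring
  rw [monodromy, Matrix.mul_fin_two, (aux hf).1, (aux hf).2, (aux hg).1, (aux hg).2]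

/-- The Wronskian identity: `p (f₁ f₂' - f₁' f₂)` is constant. -/
theorem IsFundamentalSystem.det_monodromy {F : (ℝ → ℂ) × (ℝ → ℂ)}
    (hF : IsFundamentalSystem p q lam F) (hp_pos : ∀ x, 0 < p x) (hp : Function.Periodic p T) :
    (monodromy F T).det = 1 := by
  obtain ⟨h1, h2, h3, h4, h5, h6⟩ := hF
  have hW : ∀ x, HasDerivAt
      (fun x => F.1 x * ((p x : ℂ) * deriv F.2 x) - ((p x : ℂ) * deriv F.1 x) * F.2 x) 0 x := by
    intro x
    refine (((h1.1.1 x).hasDerivAt.mul (h2.hasDerivAt_quasi x)).sub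
      ((h1.hasDerivAt_quasi x).mul (h2.1.1 x).hasDerivAt)).congr_deriv ?_
    ring
  have hc := is_const_of_deriv_eq_zero (fun x => (hW x).differentiableAt)
    (fun x => (hW x).deriv) T 0
  have hpT : p T = p 0 := by simpa using hp 0
  have hp0 : (p 0 : ℂ) ≠ 0 := by exact_mod_cast (hp_pos 0).ne'
  simp only [h3, h4, h5, h6, hpT] at hc
  rw [monodromy, Matrix.det_fin_two_of]
  refine mul_left_cancel₀ hp0 ?_
  linear_combination hc

/-- A nonzero periodic solution forces both multipliers to be `1`, as their product is `1`. -/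
theorem IsFundamentalSystem.trace_monodromy_eq_two {F : (ℝ → ℂ) × (ℝ → ℂ)}
    (hF : IsFundamentalSystem p q lam F) (h : SLUnique p q lam) (hp_pos : ∀ x, 0 < p x)
    (hp : Function.Periodic p T) {f : ℝ → ℂ} (hf : IsPeriodicEigenfunction p q T lam f) :
    (monodromy F T).trace = 2 := by
  obtain ⟨hsol, hper, hne⟩ := hf
  have hdet := hF.det_monodromy hp_pos hp
  have hm := hF.monodromy_mul (T := T) h hsol hsol
  have hfT : f T = f 0 := by simpa using hper 0
  have hfT' : deriv f T = deriv f 0 := by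
    have : (fun x => f (x + T)) = f := funext hper
    have h2 := deriv_comp_add_const (f := f) T 0
    rw [this] at h2
    simpa using h2.symm
  rw [hfT, hfT', monodromy, Matrix.mul_fin_two] at hm
  have e1 := congrFun (congrFun hm 0) 0
  have e2 := congrFun (congrFun hm 1) 0
  simp at e1 e2
  rw [monodromy, Matrix.det_fin_two_of] at hdet
  rw [trace_monodromy]
  -- As `det = 1`, the characteristic polynomial at `1` is `2 - tr`; by Cramer's rule it annihilates
  -- the Cauchy data.
  have k1 : (2 - (F.1 T + deriv F.2 T)) * f 0 = 0 := by
    linear_combination (-(f 0)) * hdet + (deriv F.2 T - 1) * e1 - F.2 T * e2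
  have k2 : (2 - (F.1 T + deriv F.2 T)) * deriv f 0 = 0 := by
    linear_combination (-(deriv f 0)) * hdet - deriv F.1 T * e1 + (F.1 T - 1) * e2
  by_contra hne2
  have h3 : 2 - (F.1 T + deriv F.2 T) ≠ 0 := fun h0 => hne2 (by linear_combination -h0)
  exact hne (funext (h f hsol ((mul_eq_zero.mp k1).resolve_left h3)
    ((mul_eq_zero.mp k2).resolve_left h3)))

/-- The equation is read as a first-order system for `f` and `p f'`. -/
theorem slUnique_of_continuous (hp_pos : ∀ x, 0 < p x) (hp : Continuous p) (hq : Continuous q)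
    (lam : ℂ) : SLUnique p q lam := by
  intro f hf h0 h1 x
  have hp' : ∀ x, (p x : ℂ) ≠ 0 := fun x => by exact_mod_cast (hp_pos x).ne'
  refine (planar_solution_eq_zero (a := fun _ => 0) (b := fun x => 1 / (p x : ℂ))
    (c := fun x => q x - lam) (d := fun _ => 0) (v := fun x => (p x : ℂ) * deriv f x)
    continuous_const (continuous_const.div (by fun_prop) hp') (by fun_prop) continuous_const
    (fun t => ?_) (fun t => ?_) h0 (by simp [h1]) x).1
  · refine (hf.1.1 t).hasDerivAt.congr_deriv ?_
    have := hp' t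
    field_simp
    ring
  · refine (hf.hasDerivAt_quasi t).congr_deriv ?_
    ring

theorem exists_slSolution_of_continuous (hp_pos : ∀ x, 0 < p x) (hp : Continuous p)
    (hq : Continuous q) (lam a b : ℂ) :
    ∃ f, IsSLSolution p q lam f ∧ f 0 = a ∧ deriv f 0 = b := by
  have hp' : ∀ x, (p x : ℂ) ≠ 0 := fun x => by exact_mod_cast (hp_pos x).ne'
  obtain ⟨u, v, hu0, hv0, hu, hv⟩ := exists_planar_solution (a := fun _ => 0)
    (b := fun x => 1 / (p x : ℂ)) (c := fun x => q x - lam) (d := fun _ => 0)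
    continuous_const (continuous_const.div (by fun_prop) hp') (by fun_prop) continuous_const
    a (p 0 * b)
  refine ⟨u, isSLSolution_of_hasDerivAt (g := v) hp_pos (fun x => ?_) (fun x => ?_), hu0, ?_⟩
  · refine (hu x).congr_deriv ?_
    ring
  · refine (hv x).congr_deriv ?_
    ring
  · rw [(hu 0).deriv, hv0]
    have := hp' 0
    field_simp
    ring

end SturmLiouville

/-! ### Factorization of the Sturm–Liouville operator -/

/-- The superpotential `Φ` solves the Riccati equation `(p^{1/2} Φ)' = lam0 - q + Φ²`, for a positive
twice differentiable `p`. This is all that the factorizations below need. -/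
structure IsRiccatiSolution (p q Φ : ℝ → ℝ) (lam0 : ℝ) : Prop where
  pos : ∀ x, 0 < p x
  diff : Differentiable ℝ p
  diff_deriv : Differentiable ℝ (deriv p)
  diff_superpotential : Differentiable ℝ Φ
  riccati : ∀ x, deriv (fun y => √(p y)) x * Φ x + √(p x) * deriv Φ x =
    lam0 - q x + Φ x ^ 2

theorem differentiable_sqrt_of_pos {p : ℝ → ℝ} (hp_pos : ∀ x, 0 < p x) (hp : Differentiable ℝ p) :
    Differentiable ℝ fun y => √(p y) :=
  fun x => (hp x).sqrt (hp_pos x).ne'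

theorem deriv_sqrt_eq {p : ℝ → ℝ} (hp_pos : ∀ x, 0 < p x) (hp : Differentiable ℝ p) :
    deriv (fun y => √(p y)) = fun x => deriv p x / (2 * √(p x)) :=
  funext fun x => ((hp x).hasDerivAt.sqrt (hp_pos x).ne').deriv

theorem two_mul_sqrt_ne_zero {p : ℝ → ℝ} (hp_pos : ∀ x, 0 < p x) (x : ℝ) : 2 * √(p x) ≠ 0 := by
  have := Real.sqrt_pos.mpr (hp_pos x)
  positivity

theorem differentiable_deriv_sqrt {p : ℝ → ℝ} (hp_pos : ∀ x, 0 < p x) (hp : Differentiable ℝ p)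
    (hp2 : Differentiable ℝ (deriv p)) : Differentiable ℝ (deriv fun y => √(p y)) := by
  rw [deriv_sqrt_eq hp_pos hp]
  exact hp2.fun_div ((differentiable_sqrt_of_pos hp_pos hp).const_mul 2)
    (two_mul_sqrt_ne_zero hp_pos)

namespace IsRiccatiSolution

variable {p q Φ : ℝ → ℝ} {lam0 : ℝ}

theorem sqrt_ne_zero (h : IsRiccatiSolution p q Φ lam0) (x : ℝ) : (√(p x) : ℂ) ≠ 0 := by
  exact_mod_cast (Real.sqrt_pos.mpr (h.pos x)).ne'

theorem sqrt_mul_sqrt (h : IsRiccatiSolution p q Φ lam0) (x : ℝ) :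
    (p x : ℂ) = (√(p x) : ℂ) * (√(p x) : ℂ) := by
  rw [← Complex.ofReal_mul, Real.mul_self_sqrt (h.pos x).le]

theorem riccati_complex (h : IsRiccatiSolution p q Φ lam0) (x : ℝ) :
    ((deriv (fun y => √(p y)) x : ℝ) : ℂ) * Φ x + √(p x) * ((deriv Φ x : ℝ) : ℂ) =
      lam0 - q x + (Φ x : ℂ) ^ 2 := by
  exact_mod_cast h.riccati x

theorem hasDerivAt_sqrt (h : IsRiccatiSolution p q Φ lam0) (x : ℝ) :
    HasDerivAt (fun y => (√(p y) : ℂ)) ((deriv (fun y => √(p y)) x : ℝ) : ℂ) x :=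
  hasDerivAt_ofReal_comp (differentiable_sqrt_of_pos h.pos h.diff) x

theorem hasDerivAt_deriv_sqrt (h : IsRiccatiSolution p q Φ lam0) (x : ℝ) :
    HasDerivAt (fun z => ((deriv (fun y => √(p y)) z : ℝ) : ℂ))
      ((deriv (deriv fun y => √(p y)) x : ℝ) : ℂ) x :=
  hasDerivAt_ofReal_comp (differentiable_deriv_sqrt h.pos h.diff h.diff_deriv) x

theorem hasDerivAt_superpotential (h : IsRiccatiSolution p q Φ lam0) (x : ℝ) :
    HasDerivAt (fun y => (Φ y : ℂ)) ((deriv Φ x : ℝ) : ℂ) x :=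
  hasDerivAt_ofReal_comp h.diff_superpotential x

theorem hasDerivAt_coeff (h : IsRiccatiSolution p q Φ lam0) (x : ℝ) :
    HasDerivAt (fun y => (p y : ℂ)) (2 * √(p x) * ((deriv (fun y => √(p y)) x : ℝ) : ℂ)) x := by
  have e : (fun y => (p y : ℂ)) = fun y => (√(p y) : ℂ) * (√(p y) : ℂ) := funext h.sqrt_mul_sqrt
  rw [e]
  exact ((h.hasDerivAt_sqrt x).mul (h.hasDerivAt_sqrt x)).congr_deriv (by ring)

theorem slDomain (h : IsRiccatiSolution p q Φ lam0) {f : ℝ → ℂ} (hf : Differentiable ℝ f)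
    (hf' : Differentiable ℝ (deriv f)) : SLDomain p f :=
  ⟨hf, fun x => ((h.hasDerivAt_coeff x).mul (hf' x).hasDerivAt).differentiableAt⟩

theorem slOp_eq (h : IsRiccatiSolution p q Φ lam0) (q' : ℝ → ℝ) {f : ℝ → ℂ} (hf : SLDomain p f)
    (x : ℝ) : slOp p q' f x = -(2 * √(p x) * ((deriv (fun y => √(p y)) x : ℝ) : ℂ) * deriv f x +
      √(p x) * √(p x) * deriv (deriv f) x) + q' x * f x := by
  have := ((h.hasDerivAt_coeff x).fun_mul
    ((hf.differentiable_deriv h.pos h.diff) x).hasDerivAt).deriv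
  rw [slOp, this, h.sqrt_mul_sqrt]

theorem hasDerivAt_sqrt_mul (h : IsRiccatiSolution p q Φ lam0) {f : ℝ → ℂ}
    (hf : Differentiable ℝ f) (x : ℝ) :
    HasDerivAt (fun y => (√(p y) : ℂ) * f y)
      (((deriv (fun y => √(p y)) x : ℝ) : ℂ) * f x + √(p x) * deriv f x) x :=
  (h.hasDerivAt_sqrt x).mul (hf x).hasDerivAt

theorem hasDerivAt_darboux (h : IsRiccatiSolution p q Φ lam0) {f : ℝ → ℂ} (hf : SLDomain p f)
    (x : ℝ) : HasDerivAt (darboux p Φ f)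
      (((deriv (fun y => √(p y)) x : ℝ) : ℂ) * deriv f x + √(p x) * deriv (deriv f) x +
        (((deriv Φ x : ℝ) : ℂ) * f x + Φ x * deriv f x)) x :=
  (h.hasDerivAt_sqrt_mul (hf.differentiable_deriv h.pos h.diff) x).add
    ((h.hasDerivAt_superpotential x).mul (hf.1 x).hasDerivAt)

theorem darbouxAdjoint_eq (h : IsRiccatiSolution p q Φ lam0) {f : ℝ → ℂ}
    (hf : Differentiable ℝ f) : darbouxAdjoint p Φ f = fun x =>
      -(((deriv (fun y => √(p y)) x : ℝ) : ℂ) * f x + √(p x) * deriv f x) + Φ x * f x :=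
  funext fun x => by rw [darbouxAdjoint, (h.hasDerivAt_sqrt_mul hf x).deriv]

theorem hasDerivAt_darbouxAdjoint (h : IsRiccatiSolution p q Φ lam0) {f : ℝ → ℂ}
    (hf : SLDomain p f) (x : ℝ) : HasDerivAt (darbouxAdjoint p Φ f)
      (-((((deriv (deriv fun y => √(p y)) x : ℝ) : ℂ) * f x +
          ((deriv (fun y => √(p y)) x : ℝ) : ℂ) * deriv f x) +
        (((deriv (fun y => √(p y)) x : ℝ) : ℂ) * deriv f x + √(p x) * deriv (deriv f) x)) +
        (((deriv Φ x : ℝ) : ℂ) * f x + Φ x * deriv f x)) x := by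
  rw [h.darbouxAdjoint_eq hf.1]
  exact (((h.hasDerivAt_deriv_sqrt x).mul (hf.1 x).hasDerivAt).add
    (h.hasDerivAt_sqrt_mul (hf.differentiable_deriv h.pos h.diff) x)).neg.add
    ((h.hasDerivAt_superpotential x).mul (hf.1 x).hasDerivAt)

theorem slOp_eq_darbouxAdjoint_darboux (h : IsRiccatiSolution p q Φ lam0) {f : ℝ → ℂ}
    (hf : SLDomain p f) (x : ℝ) :
    slOp p q f x = darbouxAdjoint p Φ (darboux p Φ f) x + (lam0 : ℂ) * f x := by
  rw [h.slOp_eq q hf, h.darbouxAdjoint_eq fun x => (h.hasDerivAt_darboux hf x).differentiableAt]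
  beta_reduce
  rw [(h.hasDerivAt_darboux hf x).deriv, darboux]
  linear_combination (f x) * h.riccati_complex x

theorem slOp_partner_eq_darboux_darbouxAdjoint (h : IsRiccatiSolution p q Φ lam0) {f : ℝ → ℂ}
    (hf : SLDomain p f) (x : ℝ) :
    slOp p (susyPartner p q Φ) f x =
      darboux p Φ (darbouxAdjoint p Φ f) x + (lam0 : ℂ) * f x := by
  rw [h.slOp_eq _ hf, darboux, (h.hasDerivAt_darbouxAdjoint hf x).deriv,
    h.darbouxAdjoint_eq hf.1, susyPartner]
  push_cast
  linear_combination (f x) * h.riccati_complex x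

/-! ### The Darboux transformation on solutions -/

theorem darbouxAdjoint_darboux_of_solution (h : IsRiccatiSolution p q Φ lam0) {lam : ℂ}
    {f : ℝ → ℂ} (hf : IsSLSolution p q lam f) (x : ℝ) :
    darbouxAdjoint p Φ (darboux p Φ f) x = (lam - lam0) * f x := by
  linear_combination hf.2 x - h.slOp_eq_darbouxAdjoint_darboux hf.1 x

theorem darboux_darbouxAdjoint_of_solution (h : IsRiccatiSolution p q Φ lam0) {lam : ℂ}
    {f : ℝ → ℂ} (hf : IsSLSolution p (susyPartner p q Φ) lam f) (x : ℝ) :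
    darboux p Φ (darbouxAdjoint p Φ f) x = (lam - lam0) * f x := by
  linear_combination hf.2 x - h.slOp_partner_eq_darboux_darbouxAdjoint hf.1 x

/-- The partner equation is equivalent to the first-order system `-(p^{1/2} f)' + Φ f = g`,
`p^{1/2} g' + Φ g = (lam - lam0) f`, written for `u = p^{1/2} f` and `g`. Its coefficients are
continuous even when the partner coefficient is not. -/
theorem isSLSolution_partner_of_system (h : IsRiccatiSolution p q Φ lam0) {lam : ℂ} {u g : ℝ → ℂ}
    (hu : ∀ x, HasDerivAt u (Φ x / √(p x) * u x - g x) x)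
    (hg : ∀ x, HasDerivAt g ((lam - lam0) / p x * u x - Φ x / √(p x) * g x) x) :
    IsSLSolution p (susyPartner p q Φ) lam (fun x => u x / √(p x)) ∧
      darbouxAdjoint p Φ (fun x => u x / √(p x)) = g := by
  set f : ℝ → ℂ := fun x => u x / √(p x) with hfdef
  have hf : Differentiable ℝ f := fun x =>
    ((hu x).fun_div (h.hasDerivAt_sqrt x) (h.sqrt_ne_zero x)).differentiableAt
  have hru : (fun y => (√(p y) : ℂ) * f y) = u :=
    funext fun y => mul_div_cancel₀ _ (h.sqrt_ne_zero y)
  have hf' : deriv f = fun x =>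
      (Φ x * f x - g x - ((deriv (fun y => √(p y)) x : ℝ) : ℂ) * f x) / √(p x) := funext fun x => by
    have h1 := h.hasDerivAt_sqrt_mul hf x
    rw [hru] at h1
    have h2 := h1.unique (hu x)
    rw [eq_div_iff (h.sqrt_ne_zero x)]
    have h3 : Φ x / √(p x) * u x = Φ x * f x := by
      rw [hfdef]
      ring
    linear_combination h2 + h3
  have hdom : SLDomain p f := h.slDomain hf <| by
    rw [hf']
    exact fun x => (((((h.hasDerivAt_superpotential x).fun_mul (hf x).hasDerivAt).fun_sub
      (hg x)).fun_sub ((h.hasDerivAt_deriv_sqrt x).fun_mul (hf x).hasDerivAt)).fun_div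
      (h.hasDerivAt_sqrt x) (h.sqrt_ne_zero x)).differentiableAt
  have hB : darbouxAdjoint p Φ f = g := funext fun x => by
    rw [darbouxAdjoint, hru, (hu x).deriv, hfdef]
    ring
  refine ⟨⟨hdom, fun x => ?_⟩, hB⟩
  rw [h.slOp_partner_eq_darboux_darbouxAdjoint hdom, hB, darboux, (hg x).deriv, hfdef,
    h.sqrt_mul_sqrt]
  have := h.sqrt_ne_zero x
  beta_reduce
  field_simp
  ring

theorem system_of_isSLSolution_partner (h : IsRiccatiSolution p q Φ lam0) {lam : ℂ} {f : ℝ → ℂ}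
    (hf : IsSLSolution p (susyPartner p q Φ) lam f) (x : ℝ) :
    HasDerivAt (fun y => (√(p y) : ℂ) * f y)
      (Φ x / √(p x) * (√(p x) * f x) - darbouxAdjoint p Φ f x) x ∧
    HasDerivAt (darbouxAdjoint p Φ f)
      ((lam - lam0) / p x * (√(p x) * f x) - Φ x / √(p x) * darbouxAdjoint p Φ f x) x := by
  have hr := h.sqrt_ne_zero x
  constructor
  · refine (h.hasDerivAt_sqrt_mul hf.1.1 x).congr_deriv ?_
    rw [h.darbouxAdjoint_eq hf.1.1]
    field_simp
    ring
  · refine (h.hasDerivAt_darbouxAdjoint hf.1 x).differentiableAt.hasDerivAt.congr_deriv ?_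
    have e := h.darboux_darbouxAdjoint_of_solution hf x
    rw [darboux] at e
    rw [h.sqrt_mul_sqrt]
    field_simp
    linear_combination e

theorem continuous_system_coeff (h : IsRiccatiSolution p q Φ lam0) :
    Continuous fun x => (Φ x : ℂ) / √(p x) :=
  (Complex.continuous_ofReal.comp h.diff_superpotential.continuous).div
    (Complex.continuous_ofReal.comp h.diff.continuous.sqrt) h.sqrt_ne_zero

theorem continuous_const_div_coeff (h : IsRiccatiSolution p q Φ lam0) (c : ℂ) :
    Continuous fun x => c / (p x : ℂ) :=
  continuous_const.div (Complex.continuous_ofReal.comp h.diff.continuous)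
    fun x => by exact_mod_cast (h.pos x).ne'

theorem slUnique_partner (h : IsRiccatiSolution p q Φ lam0) (lam : ℂ) :
    SLUnique p (susyPartner p q Φ) lam := by
  intro f hf h0 h1 x
  have := (planar_solution_eq_zero (a := fun x => Φ x / √(p x)) (b := fun _ => -1)
    (c := fun x => (lam - lam0) / p x) (d := fun x => -(Φ x / √(p x)))
    h.continuous_system_coeff continuous_const (h.continuous_const_div_coeff _)
    h.continuous_system_coeff.neg
    (fun t => (h.system_of_isSLSolution_partner hf t).1.congr_deriv (by ring))
    (fun t => (h.system_of_isSLSolution_partner hf t).2.congr_deriv (by ring))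
    (by simp [h0]) (by simp [h.darbouxAdjoint_eq hf.1.1, h0, h1]) x).1
  exact (mul_eq_zero.mp this).resolve_left (h.sqrt_ne_zero x)

theorem exists_slSolution_partner (h : IsRiccatiSolution p q Φ lam0) (lam a b : ℂ) :
    ∃ f, IsSLSolution p (susyPartner p q Φ) lam f ∧ f 0 = a ∧ deriv f 0 = b := by
  obtain ⟨u, g, hu0, hg0, hu, hg⟩ := exists_planar_solution
    (a := fun x => Φ x / √(p x)) (b := fun _ => -1)
    (c := fun x => (lam - lam0) / p x) (d := fun x => -(Φ x / √(p x)))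
    h.continuous_system_coeff continuous_const (h.continuous_const_div_coeff _)
    h.continuous_system_coeff.neg (√(p 0) * a)
    (-(((deriv (fun y => √(p y)) 0 : ℝ) : ℂ) * a + √(p 0) * b) + Φ 0 * a)
  obtain ⟨hf, hB⟩ := h.isSLSolution_partner_of_system (lam := lam)
    (fun x => (hu x).congr_deriv (by ring)) (fun x => (hg x).congr_deriv (by ring))
  have hf0 : u 0 / √(p 0) = a := by
    rw [hu0]
    exact mul_div_cancel_left₀ _ (h.sqrt_ne_zero 0)
  refine ⟨_, hf, hf0, ?_⟩
  have e := congrFun hB 0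
  rw [h.darbouxAdjoint_eq hf.1.1, hg0] at e
  beta_reduce at e
  rw [hf0] at e
  refine mul_left_cancel₀ (h.sqrt_ne_zero 0) ?_
  linear_combination -e

theorem isSLSolution_darboux (h : IsRiccatiSolution p q Φ lam0) {lam : ℂ} {f : ℝ → ℂ}
    (hf : IsSLSolution p q lam f) :
    IsSLSolution p (susyPartner p q Φ) lam (darboux p Φ f) := by
  set g := darboux p Φ f with hg
  have hgd : Differentiable ℝ g := fun x => (h.hasDerivAt_darboux hf.1 x).differentiableAt
  have hB : darbouxAdjoint p Φ g = fun x => (lam - lam0) * f x :=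
    funext (h.darbouxAdjoint_darboux_of_solution hf)
  -- `g'` is differentiable since `(p^{1/2} g)' = Φ g - (lam - lam0) f` is.
  have hg' : deriv g = fun x => (Φ x * g x - (lam - lam0) * f x -
      ((deriv (fun y => √(p y)) x : ℝ) : ℂ) * g x) / √(p x) := funext fun x => by
    have e := congrFun hB x
    rw [h.darbouxAdjoint_eq hgd] at e
    rw [eq_div_iff (h.sqrt_ne_zero x)]
    linear_combination -e
  have hdom : SLDomain p g := h.slDomain hgd <| by
    rw [hg']
    exact fun x => (((((h.hasDerivAt_superpotential x).fun_mul (hgd x).hasDerivAt).fun_sub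
      ((hf.1.1 x).hasDerivAt.const_mul (lam - lam0 : ℂ))).fun_sub
      ((h.hasDerivAt_deriv_sqrt x).fun_mul (hgd x).hasDerivAt)).fun_div
      (h.hasDerivAt_sqrt x) (h.sqrt_ne_zero x)).differentiableAt
  refine ⟨hdom, fun x => ?_⟩
  have hd : deriv (fun x => (lam - lam0) * f x) x = (lam - lam0) * deriv f x :=
    ((hf.1.1 x).hasDerivAt.const_mul (lam - lam0 : ℂ)).deriv
  rw [h.slOp_partner_eq_darboux_darbouxAdjoint hdom, hB, darboux, hd, hg, darboux]
  ring

end IsRiccatiSolution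

/-! ### The superpotential of a nodeless eigenfunction -/

theorem Function.Periodic.deriv_periodic {E : Type*} [NormedAddCommGroup E] [NormedSpace ℝ E]
    {f : ℝ → E} {T : ℝ} (h : Function.Periodic f T) : Function.Periodic (deriv f) T := by
  intro x
  rw [← deriv_comp_add_const, show (fun y => f (y + T)) = f from funext h]

theorem Differentiable.of_ofReal {f : ℝ → ℝ} (h : Differentiable ℝ fun x => (f x : ℂ)) :
    Differentiable ℝ f :=
  Complex.reCLM.differentiable.comp h

theorem deriv_ofReal_comp {f : ℝ → ℝ} (h : Differentiable ℝ f) :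
    deriv (fun x => (f x : ℂ)) = fun x => ((deriv f x : ℝ) : ℂ) :=
  funext fun x => (hasDerivAt_ofReal_comp h x).deriv

section Superpotential

variable {p q f0 : ℝ → ℝ} {T lam0 : ℝ}

theorem IsSLSolution.differentiable_ofReal
    (hf0 : IsSLSolution p q (lam0 : ℂ) fun x => (f0 x : ℂ)) : Differentiable ℝ f0 :=
  .of_ofReal hf0.1.1

theorem IsSLSolution.hasDerivAt_quasi_ofReal
    (hf0 : IsSLSolution p q (lam0 : ℂ) fun x => (f0 x : ℂ)) (x : ℝ) :
    HasDerivAt (fun y => p y * deriv f0 y) ((q x - lam0) * f0 x) x := by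
  have h := hf0.hasDerivAt_quasi x
  rw [deriv_ofReal_comp hf0.differentiable_ofReal] at h
  simpa [Function.comp_def] using Complex.reCLM.hasFDerivAt.comp_hasDerivAt x h

theorem IsSLSolution.differentiable_deriv_ofReal (hp_pos : ∀ x, 0 < p x)
    (hp : Differentiable ℝ p) (hf0 : IsSLSolution p q (lam0 : ℂ) fun x => (f0 x : ℂ)) :
    Differentiable ℝ (deriv f0) := by
  have h := hf0.1.differentiable_deriv hp_pos hp
  rw [deriv_ofReal_comp hf0.differentiable_ofReal] at h
  exact .of_ofReal h

theorem sqrt_mul_superpotential (hp_pos : ∀ x, 0 < p x) (x : ℝ) :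
    √(p x) * superpotential p f0 x = -(p x * deriv f0 x / f0 x) := by
  rw [superpotential]
  linear_combination (-(deriv f0 x / f0 x)) * Real.mul_self_sqrt (hp_pos x).le

theorem isRiccatiSolution_superpotential (hp_pos : ∀ x, 0 < p x)
    (hp : Differentiable ℝ p) (hp2 : Differentiable ℝ (deriv p))
    (hf0 : IsSLSolution p q (lam0 : ℂ) fun x => (f0 x : ℂ)) (hf0_ne : ∀ x, f0 x ≠ 0) :
    IsRiccatiSolution p q (superpotential p f0) lam0 := by
  have hr := differentiable_sqrt_of_pos hp_pos hp
  have hΦ : Differentiable ℝ (superpotential p f0) :=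
    hr.neg.mul ((hf0.differentiable_deriv_ofReal hp_pos hp).fun_div
      hf0.differentiable_ofReal hf0_ne)
  refine ⟨hp_pos, hp, hp2, hΦ, fun x => ?_⟩
  have h1 : HasDerivAt (fun y => √(p y) * superpotential p f0 y) _ x :=
    (hr x).hasDerivAt.mul (hΦ x).hasDerivAt
  rw [funext (sqrt_mul_superpotential hp_pos)] at h1
  have h2 : HasDerivAt (fun y => -(p y * deriv f0 y / f0 y)) _ x :=
    ((hf0.hasDerivAt_quasi_ofReal x).fun_div (hf0.differentiable_ofReal x).hasDerivAt
      (hf0_ne x)).fun_neg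
  rw [h1.unique h2, superpotential]
  have hs := Real.sq_sqrt (hp_pos x).le
  have := hf0_ne x
  field_simp
  rw [hs]
  ring

theorem superpotential_periodic (hp : Function.Periodic p T) (hf0 : Function.Periodic f0 T) :
    Function.Periodic (superpotential p f0) T := fun x => by
  simp only [superpotential, hp x, hf0 x, hf0.deriv_periodic x]

theorem susyPartner_periodic {Φ : ℝ → ℝ} (hp : Function.Periodic p T)
    (hq : Function.Periodic q T) (hΦ : Function.Periodic Φ T) :
    Function.Periodic (susyPartner p q Φ) T := fun x => by
  have hr : Function.Periodic (fun y => √(p y)) T := fun y => by simp only [hp y]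
  simp only [susyPartner, hp x, hq x, hΦ.deriv_periodic x, hr.deriv_periodic.deriv_periodic x]

/-- By the Riccati equation, `Φ'` is continuous even if `p''` is not. -/
theorem IsRiccatiSolution.continuous_susyPartner {Φ : ℝ → ℝ} (h : IsRiccatiSolution p q Φ lam0)
    (hq : Continuous q) (hp2 : Continuous (deriv (deriv p))) :
    Continuous (susyPartner p q Φ) := by
  have hr : Continuous fun y => √(p y) := h.diff.continuous.sqrt
  have hrd := differentiable_deriv_sqrt h.pos h.diff h.diff_deriv
  have hΦ := h.diff_superpotential.continuous
  have hp1 := h.diff_deriv.continuous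
  have hrne : ∀ x, √(p x) ≠ 0 := fun x => (Real.sqrt_pos.mpr (h.pos x)).ne'
  have hΦ' : deriv Φ = fun x =>
      (lam0 - q x + Φ x ^ 2 - deriv (fun y => √(p y)) x * Φ x) / √(p x) := funext fun x => by
    rw [eq_div_iff (hrne x)]
    linear_combination h.riccati x
  have hc : Continuous (deriv Φ) := by
    rw [hΦ']
    exact (((continuous_const.sub hq).add (hΦ.pow 2)).sub (hrd.continuous.mul hΦ)).div hr hrne
  have hr2 : deriv (deriv fun y => √(p y)) = fun x =>
      (deriv (deriv p) x * (2 * √(p x)) - deriv p x * (2 * deriv (fun y => √(p y)) x)) /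
        (2 * √(p x)) ^ 2 := funext fun x => by
    have := ((h.diff_deriv x).hasDerivAt.fun_div
      (((differentiable_sqrt_of_pos h.pos h.diff) x).hasDerivAt.const_mul 2)
      (two_mul_sqrt_ne_zero h.pos x)).deriv
    rw [← this]
    exact congrArg (fun g => deriv g x) (deriv_sqrt_eq h.pos h.diff)
  have hr2c : Continuous (deriv (deriv fun y => √(p y))) := by
    rw [hr2]
    exact ((hp2.mul (hr.const_mul 2)).sub (hp1.mul (hrd.continuous.const_mul 2))).div
      ((hr.const_mul 2).pow 2) fun x => pow_ne_zero 2 (two_mul_sqrt_ne_zero h.pos x)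
  exact (hq.add ((hr.const_mul 2).mul hc)).sub (hr.mul hr2c)

/-- At `lam0` the partner equation has the periodic solution `1 / (p^{1/2} f₀)`, which the adjoint
factor annihilates. -/
theorem isPeriodicEigenfunction_partner (hp_pos : ∀ x, 0 < p x) (hp : Differentiable ℝ p)
    (hp2 : Differentiable ℝ (deriv p)) (hp_per : Function.Periodic p T)
    (hf0 : IsPeriodicEigenfunction p q T (lam0 : ℂ) fun x => (f0 x : ℂ))
    (hf0_ne : ∀ x, f0 x ≠ 0) :
    IsPeriodicEigenfunction p (susyPartner p q (superpotential p f0)) T (lam0 : ℂ)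
      fun x => (1 / f0 x : ℂ) / √(p x) := by
  have h := isRiccatiSolution_superpotential hp_pos hp hp2 hf0.1 hf0_ne
  have hne : ∀ x, (f0 x : ℂ) ≠ 0 := fun x => by exact_mod_cast hf0_ne x
  refine ⟨(h.isSLSolution_partner_of_system (g := fun _ => 0) (fun x => ?_) fun x => ?_).1,
    fun x => ?_, fun h0 => ?_⟩
  · refine ((hasDerivAt_const x (1 : ℂ)).fun_div
      (hasDerivAt_ofReal_comp hf0.1.differentiable_ofReal x) (hne x)).congr_deriv ?_
    have h1 := hne x
    have h2 := h.sqrt_ne_zero x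
    rw [superpotential]
    push_cast
    field_simp
    ring
  · simpa using hasDerivAt_const x (0 : ℂ)
  · have : (f0 (x + T) : ℂ) = f0 x := hf0.2.1 x
    simp only [this, hp_per x]
  · exact div_ne_zero (one_div_ne_zero (hne 0)) (h.sqrt_ne_zero 0) (congrFun h0 0)

end Superpotential

/-! ### Equality of the discriminants -/

section Discriminant

variable {p q Φ : ℝ → ℝ} {T lam0 : ℝ} {lam : ℂ}

theorem darboux_linearCombination {f g : ℝ → ℂ} (hf : Differentiable ℝ f)
    (hg : Differentiable ℝ g) (a b : ℂ) :
    darboux p Φ (fun x => a * f x + b * g x) =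
      fun x => a * darboux p Φ f x + b * darboux p Φ g x := funext fun x => by
  simp only [darboux, deriv_linearCombination hf hg]
  ring

theorem darboux_comp_add_period (hp : Function.Periodic p T) (hΦ : Function.Periodic Φ T)
    (f : ℝ → ℂ) : darboux p Φ (fun x => f (x + T)) = fun x => darboux p Φ f (x + T) :=
  funext fun x => by simp only [darboux, deriv_comp_add_const, hp x, hΦ x]

/-- The Darboux transformation commutes with the translation by the period, so it carries the
monodromy of the original equation to the Cauchy data of the transformed solutions at `T`. -/
theorem darboux_mul_monodromy (h : IsRiccatiSolution p q Φ lam0) (hu : SLUnique p q lam)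
    (hp : Function.Periodic p T) (hq : Function.Periodic q T) (hΦ : Function.Periodic Φ T)
    {F : (ℝ → ℂ) × (ℝ → ℂ)} (hF : IsFundamentalSystem p q lam F) :
    !![darboux p Φ F.1 0, darboux p Φ F.2 0;
        deriv (darboux p Φ F.1) 0, deriv (darboux p Φ F.2) 0] * monodromy F T =
      !![darboux p Φ F.1 T, darboux p Φ F.2 T;
        deriv (darboux p Φ F.1) T, deriv (darboux p Φ F.2) T] := by
  have h1 := (h.isSLSolution_darboux hF.1).1.1
  have h2 := (h.isSLSolution_darboux hF.2.1).1.1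
  have aux : ∀ {f : ℝ → ℂ}, IsSLSolution p q lam f →
      darboux p Φ f T = darboux p Φ F.1 0 * f T + darboux p Φ F.2 0 * deriv f T ∧
      deriv (darboux p Φ f) T =
        deriv (darboux p Φ F.1) 0 * f T + deriv (darboux p Φ F.2) 0 * deriv f T := by
    intro f hf
    have e := congrArg (darboux p Φ) (hF.expansion hu (hf.comp_add_period hp hq))
    rw [darboux_comp_add_period hp hΦ, darboux_linearCombination hF.1.1.1 hF.2.1.1.1,
      deriv_comp_add_const] at e
    simp only [zero_add] at e
    constructor
    · have e0 := congrFun e 0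
      simp only [zero_add] at e0
      linear_combination e0
    · have e0 := congrArg (fun g => deriv g 0) e
      beta_reduce at e0
      rw [deriv_comp_add_const, deriv_linearCombination h1 h2, zero_add] at e0
      linear_combination e0
  rw [monodromy, Matrix.mul_fin_two, (aux hF.1).1, (aux hF.1).2, (aux hF.2.1).1, (aux hF.2.1).2]

/-- For `lam ≠ lam0` the Darboux transformation is injective on solutions, as the adjoint factor
inverts it up to the factor `lam - lam0`. -/
theorem det_darboux_ne_zero (h : IsRiccatiSolution p q Φ lam0) (hlam : lam ≠ lam0)
    {F : (ℝ → ℂ) × (ℝ → ℂ)} (hF : IsFundamentalSystem p q lam F) :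
    (!![darboux p Φ F.1 0, darboux p Φ F.2 0;
        deriv (darboux p Φ F.1) 0, deriv (darboux p Φ F.2) 0]).det ≠ 0 := by
  intro hdet
  obtain ⟨c, hc, hNc⟩ := Matrix.exists_mulVec_eq_zero_iff.mpr hdet
  have h1 := (h.isSLSolution_darboux hF.1)
  have h2 := (h.isSLSolution_darboux hF.2.1)
  have hf := hF.1.linearCombination hF.2.1 (c 0) (c 1)
  have e0 := congrFun hNc 0
  have e1 := congrFun hNc 1
  simp [Matrix.mulVec, dotProduct, Fin.sum_univ_two] at e0 e1
  have hz : darboux p Φ (fun x => c 0 * F.1 x + c 1 * F.2 x) = fun _ => 0 := by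
    rw [darboux_linearCombination hF.1.1.1 hF.2.1.1.1]
    refine funext (h.slUnique_partner lam _ (h1.linearCombination h2 _ _) ?_ ?_)
    · linear_combination e0
    · rw [deriv_linearCombination h1.1.1 h2.1.1]
      linear_combination e1
  have hf0 : (fun x => c 0 * F.1 x + c 1 * F.2 x) = fun _ => 0 := funext fun x => by
    have := h.darbouxAdjoint_darboux_of_solution hf x
    rw [hz] at this
    have hzero : darbouxAdjoint p Φ (fun _ => 0) x = 0 := by simp [darbouxAdjoint]
    rw [hzero] at this
    exact (mul_eq_zero.mp this.symm).resolve_left (sub_ne_zero.mpr hlam)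
  obtain ⟨g1, g2, h3, h4, h5, h6⟩ := hF
  have d0 := congrFun hf0 0
  have d1 := congrArg (fun g => deriv g 0) hf0
  beta_reduce at d1
  rw [deriv_linearCombination g1.1.1 g2.1.1, h4, h6] at d1
  simp [h3, h5] at d0 d1
  refine hc (funext fun i => ?_)
  fin_cases i
  · exact d0
  · exact d1

theorem trace_monodromy_partner_eq (h : IsRiccatiSolution p q Φ lam0) (hlam : lam ≠ lam0)
    (hu : SLUnique p q lam) (hp : Function.Periodic p T) (hq : Function.Periodic q T)
    (hΦ : Function.Periodic Φ T) {F G : (ℝ → ℂ) × (ℝ → ℂ)}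
    (hF : IsFundamentalSystem p q lam F)
    (hG : IsFundamentalSystem p (susyPartner p q Φ) lam G) :
    (monodromy G T).trace = (monodromy F T).trace := by
  have e := (hG.monodromy_mul (T := T) (h.slUnique_partner lam) (h.isSLSolution_darboux hF.1)
    (h.isSLSolution_darboux hF.2.1)).trans (darboux_mul_monodromy h hu hp hq hΦ hF).symm
  have hN := (Matrix.isUnit_iff_isUnit_det _).mpr (det_darboux_ne_zero h hlam hF).isUnit
  rw [← Matrix.trace_conj hN (monodromy F T), ← e, Matrix.mul_nonsing_inv_cancel_right]
  exact (det_darboux_ne_zero h hlam hF).isUnit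

end Discriminant

theorem mainTheorem3 (p q f0 : ℝ → ℝ) (T lam0 : ℝ) (hT : 0 < T)
    (hp_pos : ∀ x, 0 < p x)
    (hp_diff : Differentiable ℝ p) (hp_diff2 : Differentiable ℝ (deriv p))
    (hp_per : Function.Periodic p T)
    (hq_cont : Continuous q) (hq_per : Function.Periodic q T)
    (hlam0 : IsFirstPeriodicEigenvalue p q T lam0)
    (hf0 : IsPeriodicEigenfunction p q T (lam0 : ℂ) (fun x => (f0 x : ℂ)))
    (hf0_nodeless : ∀ x, f0 x ≠ 0) :
    -- the superpotential and the partner coefficient are well defined and `T`-periodic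
    Differentiable ℝ (superpotential p f0) ∧
    Function.Periodic (superpotential p f0) T ∧
    Function.Periodic (susyPartner p q (superpotential p f0)) T ∧
    (Continuous (deriv (deriv p)) → Continuous (susyPartner p q (superpotential p f0))) ∧
    -- both equations arise from one factorization, with the factors interchanged
    (∀ f : ℝ → ℂ, SLDomain p f → ∀ x,
      slOp p q f x =
        darbouxAdjoint p (superpotential p f0) (darboux p (superpotential p f0) f) x
          + (lam0 : ℂ) * f x) ∧
    (∀ f : ℝ → ℂ, SLDomain p f → ∀ x,
      slOp p (susyPartner p q (superpotential p f0)) f x =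
        darboux p (superpotential p f0) (darbouxAdjoint p (superpotential p f0) f) x
          + (lam0 : ℂ) * f x) ∧
    -- the Darboux transformation maps solutions to solutions of the partner equation
    (∀ (lam : ℂ) (f : ℝ → ℂ), IsSLSolution p q lam f →
      IsSLSolution p (susyPartner p q (superpotential p f0)) lam
        (darboux p (superpotential p f0) f)) ∧
    -- both discriminants are well defined, and they are equal
    (∀ lam : ℂ,
      (∃! F, IsFundamentalSystem p q lam F) ∧
      (∃! F, IsFundamentalSystem p (susyPartner p q (superpotential p f0)) lam F) ∧
      hillDiscriminant p (susyPartner p q (superpotential p f0)) T lam =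
        hillDiscriminant p q T lam) := by
  have h := isRiccatiSolution_superpotential hp_pos hp_diff hp_diff2 hf0.1 hf0_nodeless
  have hf0_per : Function.Periodic f0 T := fun x =>
    Complex.ofReal_injective (hf0.2.1 x)
  have hΦ := superpotential_periodic hp_per hf0_per
  refine ⟨h.diff_superpotential, hΦ, susyPartner_periodic hp_per hq_per hΦ,
    h.continuous_susyPartner hq_cont, fun f hf => h.slOp_eq_darbouxAdjoint_darboux hf,
    fun f hf => h.slOp_partner_eq_darboux_darbouxAdjoint hf,
    fun lam f hf => h.isSLSolution_darboux hf, fun lam => ?_⟩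
  have hu := slUnique_of_continuous hp_pos hp_diff.continuous hq_cont lam
  have hu' := h.slUnique_partner lam
  have hF := hu.existsUnique_fundamentalSystem
    (exists_slSolution_of_continuous hp_pos hp_diff.continuous hq_cont lam)
  have hG := hu'.existsUnique_fundamentalSystem (h.exists_slSolution_partner lam)
  refine ⟨hF, hG, ?_⟩
  obtain ⟨F, hF'⟩ := hF.exists
  obtain ⟨G, hG'⟩ := hG.exists
  rw [hillDiscriminant_eq hF hF', hillDiscriminant_eq hG hG', ← trace_monodromy,
    ← trace_monodromy]
  by_cases hlam : lam = lam0
  · subst hlam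
    rw [hF'.trace_monodromy_eq_two hu hp_pos hp_per hf0,
      hG'.trace_monodromy_eq_two hu' hp_pos hp_per
        (isPeriodicEigenfunction_partner hp_pos hp_diff hp_diff2 hp_per hf0 hf0_nodeless)]
  · exact trace_monodromy_partner_eq h hlam hu hp_per hq_per hΦ hF' hG'
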